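/- Let $\Gamma$ be a finitely generated group with a normal subgroup $V$ that is free abelian of finite rank $r$, such that the quotient $N=\Gamma/V$ is nilpotent. The group $N$ acts on $V$ by conjugation, and the eigenvalues of $t\in N$ are those of the induced $\mathbf{C}$-linear map on $V\otimes_{\mathbf{Z}}\mathbf{C}$. Then exactly one of the following holds: either $\Gamma$ is nilpotent-by-finite (it has a nilpotent subgroup of finite index), or some element $t$ of $N$ acts on $V$ with an eigenvalue that is not of absolute value $1$. In the latter case $\Gamma$ has exponential growth: for every finite generating set $S$ of $\Gamma$, if $\beta_n(\Gamma,S)$ denotes the number of elements of $\Gamma$ that are products of at most $n$ elements of $S\cup S^{-1}$, then the limit $\lim_{n\to\infty}\beta_n(\Gamma,S)^{1/n}$ exists and is strictly greater than $1$. -/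

import Mathlib

open scoped TensorProduct IsMulCommutative

/-- The ball of radius `n` about the identity in the word metric of `S`: the elements which are a
product of at most `n` factors from `S ∪ S⁻¹`, that is, the `g` with `λ_S(g) ≤ n`. -/
def wordBall {G : Type*} [Group G] (S : Set G) (n : ℕ) : Set G :=
  {g | ∃ l : List G, l.length ≤ n ∧ (∀ x ∈ l, x ∈ S ∨ x⁻¹ ∈ S) ∧ l.prod = g}

/-- The growth function `β_n(G, S)`. The ball is finite whenever `S` is finite. -/
noncomputable def growthFunction {G : Type*} [Group G] (S : Set G) (n : ℕ) : ℕ :=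
  (wordBall S n).ncard

/-- `G` has exponential growth: it is finitely generated, and for every finite generating set `S`
the growth rate `lim β_n(G, S) ^ (1 / n)` exists and is strictly greater than `1`. -/
def HasExponentialGrowth (G : Type*) [Group G] : Prop :=
  Group.FG G ∧ ∀ S : Set G, S.Finite → Subgroup.closure S = ⊤ →
    ∃ β : ℝ, 1 < β ∧
      Filter.Tendsto (fun n : ℕ => (growthFunction S n : ℝ) ^ (1 / (n : ℝ))) Filter.atTop
        (nhds β)

section Action

variable {G : Type*} [Group G] (V : Subgroup G) [V.Normal] [IsMulCommutative V]

theorem le_ker_conjNormal : V ≤ (MulAut.conjNormal : G →* MulAut V).ker := by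
  intro g hg
  rw [MonoidHom.mem_ker]
  ext h
  rw [MulAut.conjNormal_apply, MulAut.one_apply,
    setLike_mul_comm hg h.2, mul_inv_cancel_right]

/-- The conjugation action of `G ⧸ V` on the abelian normal subgroup `V`: the class of `g` sends
`v` to `g * v * g⁻¹`. -/
def quotientConj : G ⧸ V →* MulAut V :=
  QuotientGroup.lift V MulAut.conjNormal (le_ker_conjNormal V)

/-- The action of `t : G ⧸ V` on `V`, written additively, as a `ℤ`-linear map. -/
def quotientAct (t : G ⧸ V) : Additive V →ₗ[ℤ] Additive V :=
  (MonoidHom.toAdditive (quotientConj V t).toMonoidHom).toIntLinearMap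

/-- `μ` is an eigenvalue of the action of `t : G ⧸ V` on `V ⊗ ℂ`. -/
def IsActionEigenvalue (t : G ⧸ V) (μ : ℂ) : Prop :=
  Module.End.HasEigenvalue
    ((quotientAct V t).baseChange ℂ : Module.End ℂ (ℂ ⊗[ℤ] Additive V)) μ

end Action

section WordGrowth

variable {G : Type*} [Group G] {S : Set G}

theorem one_mem_wordBall (S : Set G) (n : ℕ) : (1 : G) ∈ wordBall S n :=
  ⟨[], by simp, by simp, rfl⟩

theorem wordBall_mono (S : Set G) {m n : ℕ} (h : m ≤ n) : wordBall S m ⊆ wordBall S n := by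
  rintro _ ⟨l, hl, hS, rfl⟩
  exact ⟨l, hl.trans h, hS, rfl⟩

theorem mul_mem_wordBall {m n : ℕ} {g h : G} (hg : g ∈ wordBall S m) (hh : h ∈ wordBall S n) :
    g * h ∈ wordBall S (m + n) := by
  obtain ⟨l, hl, hlS, rfl⟩ := hg
  obtain ⟨l', hl', hlS', rfl⟩ := hh
  refine ⟨l ++ l', by simp; omega, fun x hx => ?_, by simp⟩
  rcases List.mem_append.1 hx with hx | hx
  · exact hlS x hx
  · exact hlS' x hx

open scoped Pointwise in
theorem wordBall_add (S : Set G) (m n : ℕ) :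
    wordBall S (m + n) = wordBall S m * wordBall S n := by
  apply Set.Subset.antisymm
  · rintro _ ⟨l, hl, hS, rfl⟩
    refine Set.mem_mul.2 ⟨(l.take m).prod, ⟨_, by simp, fun x hx => hS x (List.mem_of_mem_take hx),
      rfl⟩, (l.drop m).prod, ⟨_, by simp; omega, fun x hx => hS x (List.mem_of_mem_drop hx), rfl⟩,
      List.prod_take_mul_prod_drop l m⟩
  · rintro _ ⟨g, hg, h, hh, rfl⟩
    exact mul_mem_wordBall hg hh

theorem wordBall_zero (S : Set G) : wordBall S 0 = {1} := by
  apply Set.Subset.antisymm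
  · rintro _ ⟨l, hl, -, rfl⟩
    simp [List.length_eq_zero_iff.1 (Nat.le_zero.1 hl)]
  · simpa using one_mem_wordBall S 0

theorem wordBall_one_subset (S : Set G) : wordBall S 1 ⊆ {1} ∪ (S ∪ S⁻¹) := by
  rintro _ ⟨l, hl, hS, rfl⟩
  match l, hl, hS with
  | [], _, _ => simp
  | [x], _, hS => simpa using Or.inr (hS x (by simp))

theorem finite_wordBall (hS : S.Finite) (n : ℕ) : (wordBall S n).Finite := by
  induction n with
  | zero => simp [wordBall_zero]
  | succ n ih =>
    rw [wordBall_add]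
    exact ih.mul (((Set.finite_singleton _).union (hS.union hS.inv)).subset
      (wordBall_one_subset S))

theorem exists_mem_wordBall (hS : Subgroup.closure S = ⊤) (g : G) : ∃ n, g ∈ wordBall S n := by
  have hg : g ∈ Submonoid.closure (S ∪ S⁻¹) := by
    rw [← Subgroup.closure_toSubmonoid, hS]
    trivial
  obtain ⟨l, hl, rfl⟩ := Submonoid.exists_list_of_mem_closure hg
  exact ⟨l.length, l, le_rfl, hl, rfl⟩

theorem prod_mem_wordBall {L : ℕ} (l : List G) (h : ∀ x ∈ l, x ∈ wordBall S L) :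
    l.prod ∈ wordBall S (L * l.length) := by
  induction l with
  | nil => exact one_mem_wordBall _ _
  | cons a l ih =>
    rw [List.prod_cons, List.length_cons, mul_add, mul_one, add_comm]
    exact mul_mem_wordBall (h a (by simp)) (ih fun x hx => h x (by simp [hx]))

theorem growthFunction_pos (hS : S.Finite) (n : ℕ) : 0 < growthFunction S n :=
  (Set.ncard_pos (finite_wordBall hS n)).2 ⟨1, one_mem_wordBall S n⟩

theorem growthFunction_add_le (S : Set G) (m n : ℕ) :
    growthFunction S (m + n) ≤ growthFunction S m * growthFunction S n := by
  unfold growthFunction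
  rw [wordBall_add]
  exact Set.natCard_mul_le

/-- The growth rate exists by Fekete's lemma, and exceeds `1` as soon as the growth function is at
least exponential along an arithmetic progression. -/
theorem exists_tendsto_growthFunction_rpow (hS : S.Finite) {L : ℕ}
    (hL : ∀ n, 2 ^ n ≤ growthFunction S (L * n)) :
    ∃ β : ℝ, 1 < β ∧
      Filter.Tendsto (fun n : ℕ => (growthFunction S n : ℝ) ^ (1 / (n : ℝ))) Filter.atTop
        (nhds β) := by
  have hpos : ∀ n, (0 : ℝ) < growthFunction S n := fun n => by
    exact_mod_cast growthFunction_pos hS n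
  have hone : ∀ n, (1 : ℝ) ≤ growthFunction S n := fun n => by
    exact_mod_cast growthFunction_pos hS n
  have hsub : Subadditive fun n => Real.log (growthFunction S n) := by
    intro m n
    rw [← Real.log_mul (hpos m).ne' (hpos n).ne']
    exact Real.log_le_log (hpos _) (by exact_mod_cast growthFunction_add_le S m n)
  have hL0 : 0 < L := by
    rcases Nat.eq_zero_or_pos L with rfl | h
    · have := hL 1
      simp [growthFunction, wordBall_zero] at this
    · exact h
  have hbdd : BddBelow (Set.range fun n : ℕ => Real.log (growthFunction S n) / n) :=
    ⟨0, by rintro _ ⟨n, rfl⟩; exact div_nonneg (Real.log_nonneg (hone n)) (Nat.cast_nonneg n)⟩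
  have hlim := hsub.tendsto_lim hbdd
  have hge : Real.log 2 / L ≤ hsub.lim := by
    have hsubseq : Filter.Tendsto (fun n : ℕ => L * n) Filter.atTop Filter.atTop :=
      Filter.tendsto_id.const_mul_atTop' hL0
    refine ge_of_tendsto (hlim.comp hsubseq) ?_
    filter_upwards [Filter.eventually_gt_atTop 0] with n hn
    have hn' : (0 : ℝ) < n := by exact_mod_cast hn
    have hL' : (0 : ℝ) < L := by exact_mod_cast hL0
    have h1 : (n : ℝ) * Real.log 2 ≤ Real.log (growthFunction S (L * n)) := by
      rw [← Real.log_pow]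
      exact Real.log_le_log (by positivity) (by exact_mod_cast hL n)
    simp only [Function.comp_apply, Nat.cast_mul]
    rw [div_le_div_iff₀ hL' (by positivity)]
    nlinarith
  refine ⟨Real.exp hsub.lim, Real.one_lt_exp_iff.2 (lt_of_lt_of_le ?_ hge), ?_⟩
  · exact div_pos (Real.log_pos one_lt_two) (by exact_mod_cast hL0)
  · refine ((Real.continuous_exp.tendsto _).comp hlim).congr fun n => ?_
    simp only [Function.comp_apply]
    rw [Real.rpow_def_of_pos (hpos n), mul_one_div]

/-- A group has exponential growth if it has two elements for which the products of length `n` are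
pairwise distinct, for every `n`. -/
theorem hasExponentialGrowth_of_injOn [Group.FG G] (a : Bool → G)
    (ha : ∀ n, Set.InjOn (fun l : List Bool => (l.map a).prod) {l | l.length = n}) :
    HasExponentialGrowth G := by
  refine ⟨inferInstance, fun S hS hgen => ?_⟩
  obtain ⟨L₀, h₀⟩ := exists_mem_wordBall hgen (a false)
  obtain ⟨L₁, h₁⟩ := exists_mem_wordBall hgen (a true)
  have hL : ∀ b, a b ∈ wordBall S (max L₀ L₁) := by
    rintro (_ | _)
    · exact wordBall_mono S (le_max_left _ _) h₀
    · exact wordBall_mono S (le_max_right _ _) h₁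
  refine exists_tendsto_growthFunction_rpow hS (L := max L₀ L₁) fun n => ?_
  have hcard : Set.ncard {l : List Bool | l.length = n} = 2 ^ n := by
    rw [← Nat.card_coe_set_eq]
    change Nat.card (List.Vector Bool n) = _
    rw [Nat.card_eq_fintype_card, card_vector, Fintype.card_bool]
  rw [← hcard, ← (ha n).ncard_image]
  refine Set.ncard_le_ncard ?_ (finite_wordBall hS _)
  rintro _ ⟨l, rfl, rfl⟩
  rw [← List.length_map (as := l) a]
  refine prod_mem_wordBall (l.map a) fun x hx => ?_
  obtain ⟨b, -, rfl⟩ := List.mem_map.1 hx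
  exact hL b

end WordGrowth

section Digits

/-- The value of a list of binary digits in base `μ`, lowest digit first. -/
noncomputable def digitValue (μ : ℂ) : List Bool → ℂ
  | [] => 0
  | b :: l => (if b then 1 else 0) + μ * digitValue μ l

theorem one_le_norm_digitValue_sub {μ : ℂ} (hμ : 2 ≤ ‖μ‖) :
    ∀ {l l' : List Bool}, l.length = l'.length → l ≠ l' →
      1 ≤ ‖digitValue μ l - digitValue μ l'‖
  | [], [], _, h => absurd rfl h
  | b :: l, b' :: l', hlen, hne => by
    have hlen' : l.length = l'.length := by simpa using hlen
    have key : digitValue μ (b :: l) - digitValue μ (b' :: l') =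
        μ * (digitValue μ l - digitValue μ l') -
          ((if b' then 1 else 0) - (if b then 1 else 0)) := by
      simp only [digitValue]; ring
    have hnorm : ‖((if b' then 1 else 0) - (if b then 1 else 0) : ℂ)‖ =
        if b = b' then 0 else 1 := by
      cases b <;> cases b' <;> simp
    by_cases hl : l = l'
    · subst hl
      have hb : b ≠ b' := fun h => hne (by rw [h])
      rw [key, sub_self, mul_zero, zero_sub, norm_neg, hnorm, if_neg hb]
    · have ih := one_le_norm_digitValue_sub hμ hlen' hl
      have h1 : (2 : ℝ) ≤ ‖μ * (digitValue μ l - digitValue μ l')‖ := by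
        rw [norm_mul]; nlinarith
      have h2 : ‖((if b' then 1 else 0) - (if b then 1 else 0) : ℂ)‖ ≤ 1 := by
        rw [hnorm]; split_ifs <;> norm_num
      rw [key]
      linarith [norm_sub_norm_le (μ * (digitValue μ l - digitValue μ l'))
        ((if b' then 1 else 0) - (if b then 1 else 0))]

end Digits

section Expanding

variable {G : Type*} [Group G] (V : Subgroup G) [V.Normal]

theorem prod_digits {f : V → ℂ} (hf : ∀ v w, f (v * w) = f v + f w) {g : G} {μ : ℂ}
    (hg : ∀ v, f (MulAut.conjNormal g v) = μ * f v) (v : V) (l : List Bool) :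
    ∃ w : V, (l.map fun b => if b then v * g else g).prod = w * g ^ l.length ∧
      f w = f v * digitValue μ l := by
  induction l with
  | nil => exact ⟨1, by simp, by simpa [digitValue] using hf 1 1⟩
  | cons b l ih =>
    obtain ⟨w, hw, hfw⟩ := ih
    refine ⟨(if b then v else 1) * MulAut.conjNormal g w, ?_, ?_⟩
    · rw [List.map_cons, List.prod_cons, hw, List.length_cons, pow_succ']
      cases b <;> simp [mul_assoc]
    · have h1 : f 1 = 0 := by simpa using hf 1 1
      rw [hf, hg, hfw, digitValue]
      cases b <;> simp [h1] <;> ring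

/-- An additive function on `V` which conjugation by `g` multiplies by a number of absolute value
at least `2` makes the group grow exponentially. -/
theorem hasExponentialGrowth_of_expanding [Group.FG G] {f : V → ℂ}
    (hf : ∀ v w, f (v * w) = f v + f w) {g : G} {μ : ℂ}
    (hg : ∀ v, f (MulAut.conjNormal g v) = μ * f v) (hμ : 2 ≤ ‖μ‖) (hne : ∃ v, f v ≠ 0) :
    HasExponentialGrowth G := by
  obtain ⟨v, hv⟩ := hne
  refine hasExponentialGrowth_of_injOn (fun b => if b then v * g else g) ?_
  intro n l hl l' hl' heq
  by_contra hne
  obtain ⟨w, hw, hfw⟩ := prod_digits V hf hg v l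
  obtain ⟨w', hw', hfw'⟩ := prod_digits V hf hg v l'
  have hlen : l.length = l'.length := hl.trans hl'.symm
  have hww : w = w' := by
    have heq' := hw.symm.trans (heq.trans hw')
    rw [hlen] at heq'
    exact Subtype.ext (mul_right_cancel heq')
  have hdig : digitValue μ l = digitValue μ l' :=
    mul_left_cancel₀ hv (by rw [← hfw, ← hfw', hww])
  have := one_le_norm_digitValue_sub hμ hlen hne
  rw [hdig, sub_self, norm_zero] at this
  norm_num at this

theorem conjNormal_pow_eigen {f : V → ℂ} {g : G} {μ : ℂ}
    (hg : ∀ v, f (MulAut.conjNormal g v) = μ * f v) (n : ℕ) (v : V) :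
    f (MulAut.conjNormal (g ^ n) v) = μ ^ n * f v := by
  induction n with
  | zero => simp
  | succ n ih => rw [pow_succ', map_mul, MulAut.mul_apply, hg, ih, pow_succ']; ring

theorem conjNormal_inv_eigen {f : V → ℂ} {g : G} {μ : ℂ}
    (hg : ∀ v, f (MulAut.conjNormal g v) = μ * f v) (hμ : μ ≠ 0) (v : V) :
    f (MulAut.conjNormal g⁻¹ v) = μ⁻¹ * f v := by
  have := hg (MulAut.conjNormal g⁻¹ v)
  rw [← MulAut.mul_apply, ← map_mul, mul_inv_cancel, map_one, MulAut.one_apply] at this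
  rw [this, inv_mul_cancel_left₀ hμ]

theorem hasExponentialGrowth_of_eigen [Group.FG G] {f : V → ℂ}
    (hf : ∀ v w, f (v * w) = f v + f w) {g : G} {μ : ℂ}
    (hg : ∀ v, f (MulAut.conjNormal g v) = μ * f v) (hμ : ‖μ‖ ≠ 1) (hne : ∃ v, f v ≠ 0) :
    HasExponentialGrowth G := by
  have main : ∀ (h : G) (ν : ℂ), (∀ v, f (MulAut.conjNormal h v) = ν * f v) → 1 < ‖ν‖ →
      HasExponentialGrowth G := by
    intro h ν hh hν
    obtain ⟨n, hn⟩ := pow_unbounded_of_one_lt 2 hν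
    exact hasExponentialGrowth_of_expanding V hf (conjNormal_pow_eigen V hh n)
      (by rw [norm_pow]; exact hn.le) hne
  have hμ0 : μ ≠ 0 := by
    rintro rfl
    obtain ⟨v, hv⟩ := hne
    have := hg (MulAut.conjNormal g⁻¹ v)
    rw [← MulAut.mul_apply, ← map_mul, mul_inv_cancel, map_one, MulAut.one_apply, zero_mul] at this
    exact hv this
  rcases hμ.lt_or_gt with hlt | hgt
  · refine main g⁻¹ μ⁻¹ (conjNormal_inv_eigen V hg hμ0) ?_
    rw [norm_inv]
    exact (one_lt_inv₀ (norm_pos_iff.2 hμ0)).2 hlt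
  · exact main g μ hg hgt

/-- In a virtually nilpotent group, the eigenvalues of conjugation on a normal subgroup are roots of
unity. -/
theorem norm_eq_one_of_isVirtuallyNilpotent (hG : Group.IsVirtuallyNilpotent G) {f : V → ℂ}
    (hf : ∀ v w, f (v * w) = f v + f w) {g : G} {μ : ℂ}
    (hg : ∀ v, f (MulAut.conjNormal g v) = μ * f v) (hne : ∃ v, f v ≠ 0) : ‖μ‖ = 1 := by
  obtain ⟨H, hH, hfin⟩ := hG
  obtain ⟨v, hv⟩ := hne
  obtain ⟨k, hk, -, hgk⟩ := Subgroup.exists_pow_mem_of_index_ne_zero hfin.index_ne_zero g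
  obtain ⟨m, hm, -, hvm⟩ := Subgroup.exists_pow_mem_of_index_ne_zero hfin.index_ne_zero (v : G)
  have hone : f 1 = 0 := by simpa using hf 1 1
  have hinv : ∀ w, f w⁻¹ = -f w := fun w => by
    have := hf w w⁻¹
    rw [mul_inv_cancel, hone] at this
    linear_combination -this
  have hpow : ∀ n : ℕ, f (v ^ n) = n * f v := fun n => by
    induction n with
    | zero => simp [hone]
    | succ n ih => rw [pow_succ, hf, ih]; push_cast; ring
  have key : ∀ (c : ℕ) (x : V) (hx : (x : G) ∈ H),
      (⟨x, hx⟩ : H) ∈ Subgroup.upperCentralSeries H c → (μ ^ k - 1) ^ c * f x = 0 := by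
    intro c
    induction c with
    | zero =>
      intro x hx hx1
      have : x = 1 := by
        rw [Subgroup.upperCentralSeries_zero, Subgroup.mem_bot] at hx1
        exact Subtype.ext (congrArg (fun y : H => (y : G)) hx1)
      simp [this, hone]
    | succ c ih =>
      intro x hx hxc
      have h1 := Subgroup.mem_upperCentralSeries_succ_iff.1 hxc ⟨g ^ k, hgk⟩
      have hval : (x * (MulAut.conjNormal (g ^ k) x)⁻¹ : V) = (x : G) * g ^ k * (x : G)⁻¹ *
          (g ^ k)⁻¹ := by
        rw [Subgroup.coe_mul, Subgroup.coe_inv, MulAut.conjNormal_apply]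
        group
      have hmem : ((x * (MulAut.conjNormal (g ^ k) x)⁻¹ : V) : G) ∈ H := by
        rw [hval]
        exact H.mul_mem (H.mul_mem (H.mul_mem hx hgk) (H.inv_mem hx)) (H.inv_mem hgk)
      have h2 := ih _ hmem (by convert h1 using 1; exact Subtype.ext hval)
      rw [hf, hinv, conjNormal_pow_eigen V hg] at h2
      rw [pow_succ]
      linear_combination -h2
  obtain ⟨c, hc⟩ := hH.nilpotent
  have h := key c (v ^ m) (by simpa using hvm) (by rw [hc]; trivial)
  rw [hpow] at h
  have hm' : (m : ℂ) ≠ 0 := by exact_mod_cast hm.ne'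
  have hμk : μ ^ k = 1 := by
    rcases mul_eq_zero.1 h with h | h
    · exact sub_eq_zero.1 (eq_zero_of_pow_eq_zero h)
    · exact absurd h (mul_ne_zero hm' hv)
  exact Complex.norm_eq_one_of_pow_eq_one hμk hk.ne'

end Expanding

section Unipotent

open Polynomial in
/-- A monic integer polynomial whose complex roots all lie in the open unit disc is a power of
`X`. -/
theorem exists_eq_X_pow_of_norm_root_lt_one {p : ℤ[X]} (hp : p.Monic)
    (h : ∀ z : ℂ, (p.map (algebraMap ℤ ℂ)).IsRoot z → ‖z‖ < 1) : ∃ n : ℕ, p = X ^ n := by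
  obtain ⟨q, hpq, hq⟩ := p.exists_eq_pow_rootMultiplicity_mul_and_not_dvd hp.ne_zero 0
  rw [C_0, sub_zero] at hpq hq
  generalize p.rootMultiplicity 0 = n at hpq
  have hqm : q.Monic := (monic_X_pow n).of_mul_monic_left (hpq ▸ hp)
  have hq0 : q.coeff 0 ≠ 0 := fun h0 => hq (X_dvd_iff.2 h0)
  have hQm : (q.map (algebraMap ℤ ℂ)).Monic := hqm.map _
  have hcoeff := (IsAlgClosed.splits (q.map (algebraMap ℤ ℂ))).coeff_zero_eq_prod_roots_of_monic hQm
  have hroot : ∀ z ∈ (q.map (algebraMap ℤ ℂ)).roots, ‖z‖ < 1 := fun z hz => by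
    refine h z ?_
    rw [hpq, Polynomial.map_mul, IsRoot.def, eval_mul, ((mem_roots hQm.ne_zero).1 hz).eq_zero,
      mul_zero]
  have hdeg : (q.map (algebraMap ℤ ℂ)).roots = 0 := by
    by_contra hne
    have hlt : ∀ s : Multiset ℂ, (∀ z ∈ s, ‖z‖ < 1) → s ≠ 0 → ‖s.prod‖ < 1 := by
      intro s
      induction s using Multiset.induction with
      | empty => intro _ h; exact absurd rfl h
      | cons a s ih =>
        intro hs _
        rw [Multiset.prod_cons, norm_mul]
        have ha := hs a (by simp)
        by_cases hs0 : s = 0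
        · simpa [hs0] using ha
        · have := ih (fun z hz => hs z (by simp [hz])) hs0
          nlinarith [norm_nonneg a, norm_nonneg s.prod]
    have h1 := hlt _ hroot hne
    have h2 : ‖(q.map (algebraMap ℤ ℂ)).coeff 0‖ = ‖(q.map (algebraMap ℤ ℂ)).roots.prod‖ := by
      rw [hcoeff, norm_mul, norm_pow, norm_neg, norm_one, one_pow, one_mul]
    rw [coeff_map, eq_intCast, Complex.norm_intCast] at h2
    have h3 : (1 : ℝ) ≤ |(q.coeff 0 : ℝ)| := by exact_mod_cast Int.one_le_abs hq0
    linarith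
  have hnat : q.natDegree = 0 := by
    rw [← hqm.natDegree_map (algebraMap ℤ ℂ),
      (IsAlgClosed.splits (q.map (algebraMap ℤ ℂ))).natDegree_eq_card_roots, hdeg,
      Multiset.card_zero]
  exact ⟨n, by rw [hpq, hqm.natDegree_eq_zero.1 hnat, mul_one]⟩

variable {M : Type*} [AddCommGroup M] [Module.Free ℤ M] [Module.Finite ℤ M]

/-- An integral endomorphism congruent to `1` modulo `3`, all of whose eigenvalues have absolute
value `1`, is unipotent. -/
theorem isNilpotent_of_norm_eigenvalue_eq_one {T B : Module.End ℤ M} (hT : T = 1 + (3 : ℤ) • B)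
    (h : ∀ μ : ℂ, Module.End.HasEigenvalue (T.baseChange ℂ : Module.End ℂ (ℂ ⊗[ℤ] M)) μ →
      ‖μ‖ = 1) : IsNilpotent (T - 1) := by
  obtain ⟨n, hn⟩ := exists_eq_X_pow_of_norm_root_lt_one B.charpoly_monic (fun z hz => by
    rw [← LinearMap.charpoly_baseChange, ← Module.End.hasEigenvalue_iff_isRoot_charpoly] at hz
    obtain ⟨x, hx⟩ := hz.exists_hasEigenvector
    have hTx : (T.baseChange ℂ) x = (1 + 3 * z) • x := by
      have hTB : T.baseChange ℂ = LinearMap.id + (3 : ℤ) • B.baseChange ℂ := by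
        rw [hT, LinearMap.baseChange_add, LinearMap.baseChange_smul]
        congr 1
        exact LinearMap.baseChange_id
      rw [hTB, LinearMap.add_apply, LinearMap.smul_apply, hx.apply_eq_smul, LinearMap.id_apply,
        add_smul, one_smul, mul_smul]
      congr 1
      rw [← Int.cast_smul_eq_zsmul ℂ]
      norm_num
    have h1 := h _ (Module.End.hasEigenvalue_of_hasEigenvector
      (Module.End.hasEigenvector_iff.2 ⟨Module.End.mem_eigenspace_iff.2 hTx, hx.2⟩))
    have h2 : ‖3 * z‖ ≤ ‖1 + 3 * z‖ + ‖(1 : ℂ)‖ := by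
      simpa using norm_sub_le (1 + 3 * z) 1
    rw [h1, norm_one, norm_mul, Complex.norm_ofNat] at h2
    linarith)
  have hB := B.aeval_self_charpoly
  rw [hn, map_pow, Polynomial.aeval_X] at hB
  exact ⟨n, by rw [hT, add_sub_cancel_left, smul_pow, hB, smul_zero]⟩

/-- The principal congruence subgroup of level `3` has finite index. -/
theorem exists_finiteIndex_congruence {N : Type*} [Group N] (ρ : N →* Module.End ℤ M) :
    ∃ K : Subgroup N, K.FiniteIndex ∧ ∀ t ∈ K, ∃ B : Module.End ℤ M, ρ t = 1 + (3 : ℤ) • B := by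
  let b := Module.Free.chooseBasis ℤ M
  let ι := Module.Free.ChooseBasisIndex ℤ M
  let A : Module.End ℤ M ≃ₐ[ℤ] Matrix ι ι ℤ := LinearMap.toMatrixAlgEquiv b
  let red : Matrix ι ι ℤ →+* Matrix ι ι (ZMod 3) := (Int.castRingHom (ZMod 3)).mapMatrix
  let φ : N →* Matrix ι ι (ZMod 3) := (red : Matrix ι ι ℤ →* Matrix ι ι (ZMod 3)).comp
    ((A : Module.End ℤ M →* Matrix ι ι ℤ).comp ρ)
  have : Finite (Matrix ι ι (ZMod 3)) :=
    inferInstanceAs (Finite (ι → ι → ZMod 3))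
  have : Finite (Matrix ι ι (ZMod 3))ˣ := Finite.of_injective _ Units.val_injective
  refine ⟨φ.toHomUnits.ker, inferInstance, fun t ht => ?_⟩
  have h1 : red (A (ρ t)) = 1 := congrArg Units.val ht
  have h2 : ∀ i j, (3 : ℤ) ∣ (A (ρ t) - 1) i j := fun i j => by
    have h3 : red (A (ρ t) - 1) i j = 0 := by rw [map_sub, h1, map_one, sub_self]; rfl
    exact (ZMod.intCast_zmod_eq_zero_iff_dvd _ 3).1 h3
  choose C hC using h2
  refine ⟨A.symm (Matrix.of C), A.injective ?_⟩
  rw [map_add, map_one, map_zsmul, AlgEquiv.apply_symm_apply, ← sub_eq_iff_eq_add']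
  ext i j
  rw [hC, Matrix.smul_apply, Matrix.of_apply, smul_eq_mul]

end Unipotent

section Kolchin

open scoped commutatorElement

variable {N k W : Type*} [Group N] [Field k] [AddCommGroup W] [Module k W]

/-- The ascending chain of subspaces on whose successive quotients `N` acts trivially. -/
def unipotentFlag (ρ : N →* Module.End k W) : ℕ → Submodule k W
  | 0 => ⊥
  | n + 1 => ⨅ g : N, (unipotentFlag ρ n).comap (ρ g - 1)

variable {ρ : N →* Module.End k W}

theorem mem_unipotentFlag_succ {n : ℕ} {w : W} :
    w ∈ unipotentFlag ρ (n + 1) ↔ ∀ g, ρ g w - w ∈ unipotentFlag ρ n := by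
  simp [unipotentFlag]

theorem map_mem_unipotentFlag (n : ℕ) (g : N) {w : W} (hw : w ∈ unipotentFlag ρ n) :
    ρ g w ∈ unipotentFlag ρ n := by
  induction n generalizing w with
  | zero =>
    have : w = 0 := hw
    rw [this, map_zero]
    exact zero_mem _
  | succ n ih =>
    rw [mem_unipotentFlag_succ] at hw ⊢
    intro h
    have h1 := ih (hw (g⁻¹ * h * g))
    rwa [map_sub, ← Module.End.mul_apply, ← map_mul, ← mul_assoc, ← mul_assoc, mul_inv_cancel,
      one_mul, map_mul, Module.End.mul_apply] at h1

theorem monotone_unipotentFlag : Monotone (unipotentFlag ρ) :=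
  monotone_nat_of_le_succ fun n _ hw => mem_unipotentFlag_succ.2 fun g =>
    Submodule.sub_mem _ (map_mem_unipotentFlag n g hw) hw

/-- Kolchin's theorem for nilpotent groups: a nilpotent group of unipotent operators acts trivially
on the quotients of a finite flag. -/
theorem exists_unipotentFlag_eq_top [FiniteDimensional k W] [hN : Group.IsNilpotent N]
    (hρ : ∀ g, IsNilpotent (ρ g - 1)) : ∃ n, unipotentFlag ρ n = ⊤ := by
  obtain ⟨n, hn⟩ := monotone_stabilizes_iff_noetherian.2 (inferInstance : IsNoetherian k W)
    ⟨unipotentFlag ρ, monotone_unipotentFlag⟩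
  refine ⟨n, by_contra fun hne => ?_⟩
  have hstab : ∀ w, (∀ g, ρ g w - w ∈ unipotentFlag ρ n) → w ∈ unipotentFlag ρ n := fun w hw => by
    have : unipotentFlag ρ n = unipotentFlag ρ (n + 1) := hn (n + 1) n.le_succ
    rw [this]
    exact mem_unipotentFlag_succ.2 hw
  have hinv := fun g w => map_mem_unipotentFlag (ρ := ρ) n g (w := w)
  generalize unipotentFlag ρ n = F at hne hstab hinv
  obtain ⟨U, ⟨hFU, hU⟩, hmin⟩ := WellFounded.has_min (wellFounded_lt (α := Submodule k W))
    {U | F < U ∧ ∀ g, ∀ u ∈ U, ρ g u ∈ U} ⟨⊤, lt_top_iff_ne_top.2 hne, fun _ _ _ => trivial⟩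
  have key : ∀ m, ∀ x ∈ Subgroup.upperCentralSeries N m, ∀ u ∈ U, ρ x u - u ∈ F := by
    intro m
    induction m with
    | zero =>
      intro x hx u _
      rw [Subgroup.upperCentralSeries_zero, Subgroup.mem_bot] at hx
      simp [hx]
    | succ m ih =>
      intro x hx
      let U' : Submodule k W := U ⊓ F.comap (ρ x - 1)
      have hmem : ∀ u, u ∈ U' ↔ u ∈ U ∧ ρ x u - u ∈ F := fun u => by simp [U']
      have hU' : ∀ g, ∀ u ∈ U', ρ g u ∈ U' := by
        intro g u hu
        rw [hmem] at hu ⊢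
        refine ⟨hU g u hu.1, ?_⟩
        have hc := ih _ (Subgroup.mem_upperCentralSeries_succ_iff.1
          (Subgroup.inv_mem _ hx) g⁻¹) u hu.1
        have h1 := F.add_mem (hinv (g * x) _ hc) (hinv g _ hu.2)
        have h2 : g * x * ⁅x⁻¹, g⁻¹⁆ = x * g := by
          rw [commutatorElement_def]; group
        rw [map_sub, ← Module.End.mul_apply, ← map_mul, h2, map_sub, map_mul, map_mul,
          Module.End.mul_apply, Module.End.mul_apply] at h1
        simpa using h1
      have hFU' : F ≤ U' := fun w hw => (hmem w).2 ⟨hFU.le hw, F.sub_mem (hinv x w hw) hw⟩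
      have hlt : F < U' := by
        refine lt_of_le_of_ne hFU' fun heq => ?_
        obtain ⟨u, huU, huF⟩ := SetLike.exists_of_lt hFU
        have hiter : ∀ j : ℕ, ((ρ x - 1) ^ j) u ∈ U ∧ ((ρ x - 1) ^ j) u ∉ F := by
          intro j
          induction j with
          | zero => exact ⟨huU, huF⟩
          | succ j ihj =>
            rw [pow_succ', Module.End.mul_apply]
            refine ⟨U.sub_mem (hU x _ ihj.1) ihj.1, fun hj => ihj.2 ?_⟩
            rw [heq]
            exact (hmem _).2 ⟨ihj.1, hj⟩
        obtain ⟨j, hj⟩ := hρ x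
        exact (hiter j).2 (by rw [hj]; exact F.zero_mem)
      have hUU' : U' = U := by
        by_contra hne'
        exact hmin U' ⟨hlt, hU'⟩ (lt_of_le_of_ne inf_le_left hne')
      intro u hu
      exact ((hmem u).1 (hUU' ▸ hu)).2
  obtain ⟨c, hc⟩ := hN.nilpotent
  obtain ⟨u, huU, huF⟩ := SetLike.exists_of_lt hFU
  exact huF (hstab u fun g => key c g (by rw [hc]; trivial) u huU)

end Kolchin

/-- An extension of a nilpotent group by a subgroup of some term of the upper central series is
nilpotent. -/
theorem isNilpotent_of_ker_le_upperCentralSeries {G H : Type*} [Group G] [Group H] (f : G →* H)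
    [hH : Group.IsNilpotent H] {c : ℕ} (hf : f.ker ≤ Subgroup.upperCentralSeries G c) :
    Group.IsNilpotent G := by
  have key : ∀ n x, f x ∈ Subgroup.upperCentralSeries H n →
      x ∈ Subgroup.upperCentralSeries G (c + n) := by
    intro n
    induction n with
    | zero => exact fun x hx => hf hx
    | succ n ih =>
      intro x hx
      rw [← add_assoc, Subgroup.mem_upperCentralSeries_succ_iff]
      intro y
      refine ih _ ?_
      rw [map_commutatorElement]
      exact Subgroup.mem_upperCentralSeries_succ_iff.1 hx (f y)
  obtain ⟨n, hn⟩ := hH.nilpotent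
  exact ⟨c + n, eq_top_iff.2 fun x _ => key n x (by rw [hn]; trivial)⟩

section Assembly

open scoped commutatorElement

variable {G : Type*} [Group G] (V : Subgroup G) [V.Normal] [IsMulCommutative V]

/-- The action of `G ⧸ V` on `V`, as a representation. -/
def quotientActHom : G ⧸ V →* Module.End ℤ (Additive V) where
  toFun := quotientAct V
  map_one' := by
    refine LinearMap.ext fun v => ?_
    change Additive.ofMul (quotientConj V 1 v.toMul) = v
    rw [map_one]; rfl
  map_mul' s t := by
    refine LinearMap.ext fun v => ?_
    change Additive.ofMul (quotientConj V (s * t) v.toMul) = _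
    rw [map_mul]; rfl

/-- An eigenvalue is also attained by an additive function on `V`. -/
theorem exists_eigenfunction [Module.Free ℤ (Additive V)] [Module.Finite ℤ (Additive V)] {g : G}
    {μ : ℂ} (h : IsActionEigenvalue V (g : G ⧸ V) μ) :
    ∃ f : V → ℂ, (∀ v w, f (v * w) = f v + f w) ∧
      (∀ v, f (MulAut.conjNormal g v) = μ * f v) ∧ ∃ v, f v ≠ 0 := by
  set T : Module.End ℂ (ℂ ⊗[ℤ] Additive V) := (quotientAct V (g : G ⧸ V)).baseChange ℂ
  have hT : LinearMap.range (T - algebraMap ℂ _ μ) < ⊤ := by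
    refine lt_top_iff_ne_top.2 fun htop => ?_
    have hker := LinearMap.ker_eq_bot_iff_range_eq_top.2 htop
    obtain ⟨x, hx⟩ := Module.End.HasEigenvalue.exists_hasEigenvector h
    refine hx.2 ?_
    have : x ∈ LinearMap.ker (T - algebraMap ℂ _ μ) := by
      rw [LinearMap.mem_ker, LinearMap.sub_apply, Module.algebraMap_end_apply, sub_eq_zero]
      exact hx.apply_eq_smul
    rwa [hker, Submodule.mem_bot] at this
  obtain ⟨l, hl0, hl⟩ := Submodule.exists_le_ker_of_lt_top _ hT
  have hlT : ∀ x, l (T x) = μ * l x := fun x => by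
    have := hl ⟨x, rfl⟩
    rwa [LinearMap.mem_ker, LinearMap.sub_apply, Module.algebraMap_end_apply, map_sub, map_smul,
      smul_eq_mul, sub_eq_zero] at this
  refine ⟨fun v => l (1 ⊗ₜ Additive.ofMul v), fun v w => ?_, fun v => ?_, ?_⟩
  · simp only [ofMul_mul]
    rw [TensorProduct.tmul_add, map_add]
  · exact hlT (1 ⊗ₜ Additive.ofMul v)
  · by_contra hall
    push Not at hall
    refine hl0 (LinearMap.ext fun x => ?_)
    induction x using TensorProduct.induction_on with
    | zero => simp
    | add x y hx hy => simp only [map_add, hx, hy]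
    | tmul z v =>
      rw [← mul_one z, ← smul_eq_mul, ← TensorProduct.smul_tmul', map_smul]
      simp [show l (1 ⊗ₜ[ℤ] v) = 0 from hall v.toMul]

/-- If all eigenvalues have absolute value `1` then the group is nilpotent-by-finite. -/
theorem isVirtuallyNilpotent_of_norm_eigenvalue [Module.Free ℤ (Additive V)]
    [Module.Finite ℤ (Additive V)] [Group.IsNilpotent (G ⧸ V)]
    (h : ∀ (t : G ⧸ V) (μ : ℂ), IsActionEigenvalue V t μ → ‖μ‖ = 1) :
    Group.IsVirtuallyNilpotent G := by
  obtain ⟨K, hK, hKB⟩ := exists_finiteIndex_congruence (quotientActHom V)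
  let ρ : K →* Module.End ℂ (ℂ ⊗[ℤ] Additive V) :=
    (Module.End.baseChangeHom ℤ ℂ (Additive V) : _ →* _).comp
      ((quotientActHom V).comp K.subtype)
  have hρ : ∀ g, IsNilpotent (ρ g - 1) := fun g => by
    obtain ⟨B, hB⟩ := hKB g g.2
    have h1 := (isNilpotent_of_norm_eigenvalue_eq_one hB (h g)).map
      (Module.End.baseChangeHom ℤ ℂ (Additive V))
    rwa [map_sub, map_one] at h1
  obtain ⟨c, hc⟩ := exists_unipotentFlag_eq_top hρ
  let H : Subgroup G := K.comap (QuotientGroup.mk' V)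
  let π : H →* K := (QuotientGroup.mk' V).subgroupComap K
  refine ⟨H, isNilpotent_of_ker_le_upperCentralSeries π (c := c) ?_, ⟨?_⟩⟩
  swap
  · rw [Subgroup.index_comap_of_surjective _ (QuotientGroup.mk'_surjective V)]
    exact hK.index_ne_zero
  have key : ∀ (n : ℕ) (x : H) (hx : (x : G) ∈ V),
      (1 : ℂ) ⊗ₜ[ℤ] Additive.ofMul (⟨x, hx⟩ : V) ∈ unipotentFlag ρ n →
        x ∈ Subgroup.upperCentralSeries H n := by
    intro n
    induction n with
    | zero =>
      intro x hx h0
      have h1 : (1 : ℂ) ⊗ₜ[ℤ] Additive.ofMul (⟨x, hx⟩ : V) = 0 := h0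
      have hinj : Function.Injective fun v : Additive V => (1 : ℂ) ⊗ₜ[ℤ] v :=
        fun v w hvw => (TensorProduct.lid ℤ (Additive V)).symm.injective
          (Module.Flat.rTensor_preserves_injective_linearMap (M := Additive V)
            (Algebra.linearMap ℤ ℂ) (algebraMap ℤ ℂ).injective_int (by simpa using hvw))
      have h2 := hinj (h1.trans (TensorProduct.tmul_zero _ _).symm)
      have h3 : (x : G) = 1 := congrArg (fun v : Additive V => (v.toMul : G)) h2
      rw [Subgroup.upperCentralSeries_zero, Subgroup.mem_bot]
      exact Subtype.ext h3
    | succ n ih =>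
      intro x hx hxn
      rw [Subgroup.mem_upperCentralSeries_succ_iff]
      intro y
      have h1 := mem_unipotentFlag_succ.1 hxn (π y)
      rw [← neg_mem_iff] at h1
      have hval : ((⟨x, hx⟩ * (MulAut.conjNormal (y : G) ⟨x, hx⟩)⁻¹ : V) : G) =
          ((⁅x, y⁆ : H) : G) := by
        rw [Subgroup.coe_mul, Subgroup.coe_inv, MulAut.conjNormal_apply, commutatorElement_def]
        push_cast
        group
      refine ih _ (hval ▸ SetLike.coe_mem _) ?_
      convert h1 using 1
      have h2 : ρ (π y) ((1 : ℂ) ⊗ₜ[ℤ] Additive.ofMul (⟨x, hx⟩ : V)) =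
          (1 : ℂ) ⊗ₜ[ℤ] Additive.ofMul (MulAut.conjNormal (y : G) (⟨x, hx⟩ : V)) := rfl
      rw [h2, neg_sub, ← TensorProduct.tmul_sub]
      congr 1
      exact congrArg Additive.ofMul ((Subtype.ext hval.symm).trans (div_eq_mul_inv _ _).symm)
  intro x hx
  have hxV : (x : G) ∈ V := (QuotientGroup.eq_one_iff _).1 (congrArg Subtype.val hx)
  exact key c x hxV (by rw [hc]; trivial)

end Assembly

theorem corollary3p4 {Γ : Type*} [Group Γ] [Group.FG Γ]
    (V : Subgroup Γ) [V.Normal] [IsMulCommutative V]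
    (r : ℕ) (hfree : Module.Free ℤ (Additive V))
    (hrank : Module.rank ℤ (Additive V) = (r : Cardinal))
    (hnil : Group.IsNilpotent (Γ ⧸ V)) :
    Xor (Group.IsVirtuallyNilpotent Γ)
      (∃ (t : Γ ⧸ V) (μ : ℂ), IsActionEigenvalue V t μ ∧ ‖μ‖ ≠ 1) ∧
    ((∃ (t : Γ ⧸ V) (μ : ℂ), IsActionEigenvalue V t μ ∧ ‖μ‖ ≠ 1) →
      HasExponentialGrowth Γ) := by
  have : Module.Finite ℤ (Additive V) :=
    Module.rank_lt_aleph0_iff.1 (hrank ▸ Cardinal.natCast_lt_aleph0)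
  refine ⟨?_, ?_⟩
  · by_cases h : ∃ (t : Γ ⧸ V) (μ : ℂ), IsActionEigenvalue V t μ ∧ ‖μ‖ ≠ 1
    · refine Or.inr ⟨h, fun hvn => ?_⟩
      obtain ⟨t, μ, ht, hμ⟩ := h
      obtain ⟨g, rfl⟩ := QuotientGroup.mk_surjective t
      obtain ⟨f, hf, hfg, hne⟩ := exists_eigenfunction V ht
      exact hμ (norm_eq_one_of_isVirtuallyNilpotent V hvn hf hfg hne)
    · refine Or.inl ⟨isVirtuallyNilpotent_of_norm_eigenvalue V fun t μ ht => ?_, h⟩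
      by_contra hμ
      exact h ⟨t, μ, ht, hμ⟩
  · rintro ⟨t, μ, ht, hμ⟩
    obtain ⟨g, rfl⟩ := QuotientGroup.mk_surjective t
    obtain ⟨f, hf, hfg, hne⟩ := exists_eigenfunction V ht
    exact hasExponentialGrowth_of_eigen V hf hfg hμ hne
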